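/- Let $d\in\mathbb{N}$, $\tau\in(0,\infty)$, $\eta\in\mathbb{R}^d$, $n\in\{0,1,2,\ldots\}$, $K,L\in(0,\infty)$, $H\in\mathbb{R}$ and $\alpha,\beta_1,\beta_2,\gamma\in(0,1]$; let $\|\cdot\|$ be the Euclidean norm on $\mathbb{R}^d$ and $x\wedge y=\min\{x,y\}$. Then there exist constants $C_0,C_1,\ldots,C_n\ge 0$ (depending only on $d,\tau,\eta,n,K,H,L,\alpha,\beta_1,\beta_2,\gamma$) such that the following holds for every $f:[0,\infty)\times\mathbb{R}^d\times\mathbb{R}^d\to\mathbb{R}^d$ that satisfies (F1) $f$ is continuous; (F2) $\|f(t,y,z)\|\le K(1+\|y\|)(1+\|z\|)$ for all $t\ge 0$, $y,z\in\mathbb{R}^d$; (F3) $\langle y_1-y_2,\,f(t,y_1,z)-f(t,y_2,z)\rangle\le H(1+\|z\|)\|y_1-y_2\|^2$ for all $t\ge0$, $y_1,y_2,z\in\mathbb{R}^d$; (F4) for all $t_1,t_2\ge 0$, $y_1,y_2,z_1,z_2\in\mathbb{R}^d$, $$\|f(t_1,y_1,z_1)-f(t_2,y_2,z_2)\|\le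 L\Bigl((1+\|y_1\|+\|y_2\|)(1+\|z_1\|+\|z_2\|)|t_1-t_2|^{\alpha}+(1+\|z_1\|+\|z_2\|)\bigl(\|y_1-y_2\|^{\beta_1}+\|y_1-y_2\|^{\beta_2}\bigr)+(1+\|y_1\|+\|y_2\|)\|z_1-z_2\|^{\gamma}\Bigr).$$ The delay differential equation $$z'(t)=f(t,z(t),z(t-\tau)),\quad t\in[0,(n+1)\tau],\qquad z(t)=\eta,\quad t\in[-\tau,0],$$ (with one-sided derivatives at $0$ and $(n+1)\tau$) has a unique solution $z$ on $[-\tau,(n+1)\tau]$. For $N\in\mathbb{N}$, $N\ge 1$, put $h=\tau/N$ and $t_k^j=j\tau+kh$, and define the Euler scheme for $0\le j\le n$, $0\le k\le N$ by $$y_0^0=\eta,\qquad y_{k+1}^0=y_k^0+h\,f(t_k^0,y_k^0,\eta),$$ $$y_0^j=y_N^{j-1},\qquad y_{k+1}^j=y_k^j+h\,f(t_k^j,y_k^j,y_k^{j-1})\qquad(1\le j\le n).$$ Then for every integer $N\ge 2\lceil\tau\rceil$: $$\max_{0\le k\le N}\|z(t_k^0)-y_k^0\|\le C_0\bigl(h^{\alpha\wedge\gamma}+h^{\beta_1}+h^{\beta_2}\bigr),$$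 and for $j=1,\ldots,n$ $$\max_{0\le k\le N}\|z(t_k^j)-y_k^j\|\le C_j\sum_{l=1}^{j}\Bigl(h^{\frac12\gamma^{l-1}}+h^{\gamma^l(\alpha\wedge\gamma)}+h^{\beta_1\gamma^l}+h^{\beta_2\gamma^l}\Bigr).$$ In particular, if $\gamma=1$, then for $j=1,\ldots,n$ $$\max_{0\le k\le N}\|z(t_k^j)-y_k^j\|\le j\,C_j\bigl(h^{1/2}+h^{\alpha}+h^{\beta_1}+h^{\beta_2}\bigr).$$ -/

import Mathlib

/-- The assumptions on the right-hand side `f : [0, ∞) × ℝᵈ × ℝᵈ → ℝᵈ` of the delay equation, with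
all constants explicit. Values `f t y z` with `t < 0` are irrelevant. -/
structure DDEAssumptions {d : ℕ}
    (f : ℝ → EuclideanSpace ℝ (Fin d) → EuclideanSpace ℝ (Fin d) → EuclideanSpace ℝ (Fin d))
    (K H L α β₁ β₂ γ : ℝ) : Prop where
  /-- continuity on `[0, ∞) × ℝᵈ × ℝᵈ` -/
  F1 : ContinuousOn
    (fun p : ℝ × EuclideanSpace ℝ (Fin d) × EuclideanSpace ℝ (Fin d) => f p.1 p.2.1 p.2.2)
    (Set.Ici 0 ×ˢ Set.univ)
  /-- linear growth -/
  F2 : ∀ t, 0 ≤ t → ∀ y z, ‖f t y z‖ ≤ K * (1 + ‖y‖) * (1 + ‖z‖)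
  /-- one-sided Lipschitz condition in `y` -/
  F3 : ∀ t, 0 ≤ t → ∀ z y₁ y₂,
    inner ℝ (y₁ - y₂) (f t y₁ z - f t y₂ z) ≤ H * (1 + ‖z‖) * ‖y₁ - y₂‖ ^ 2
  /-- local Hölder condition -/
  F4 : ∀ t₁ t₂, 0 ≤ t₁ → 0 ≤ t₂ → ∀ y₁ y₂ z₁ z₂,
    ‖f t₁ y₁ z₁ - f t₂ y₂ z₂‖ ≤
      L * ((1 + ‖y₁‖ + ‖y₂‖) * (1 + ‖z₁‖ + ‖z₂‖) * |t₁ - t₂| ^ α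
        + (1 + ‖z₁‖ + ‖z₂‖) * ‖y₁ - y₂‖ ^ β₁
        + (1 + ‖z₁‖ + ‖z₂‖) * ‖y₁ - y₂‖ ^ β₂
        + (1 + ‖y₁‖ + ‖y₂‖) * ‖z₁ - z₂‖ ^ γ)

/-- `z` solves `z'(t) = f(t, z(t), z(t - τ))` on `[0, (n + 1) τ]` with `z = η` on `[-τ, 0]`
(the derivatives at the end points `0` and `(n + 1) τ` are one-sided). -/
structure IsDDESolution {d : ℕ}
    (f : ℝ → EuclideanSpace ℝ (Fin d) → EuclideanSpace ℝ (Fin d) → EuclideanSpace ℝ (Fin d))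
    (τ : ℝ) (η : EuclideanSpace ℝ (Fin d)) (n : ℕ) (z : ℝ → EuclideanSpace ℝ (Fin d)) :
    Prop where
  history : ∀ t ∈ Set.Icc (-τ) 0, z t = η
  deriv_eq : ∀ t ∈ Set.Icc 0 (((n : ℝ) + 1) * τ),
    HasDerivWithinAt z (f t (z t) (z (t - τ))) (Set.Icc 0 (((n : ℝ) + 1) * τ)) t

/-- The grid point `t_k^j = j τ + k h`, where `h = τ / N`. -/
noncomputable def gridPoint (τ : ℝ) (N j k : ℕ) : ℝ :=
  (j : ℝ) * τ + (k : ℝ) * (τ / (N : ℝ))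

/-- The Euler recursion on the `j`-th interval `[j τ, (j + 1) τ]`, with initial value `y₀` and
with `w k` in place of the delayed value at the `k`-th grid point. -/
noncomputable def eulerOnInterval {d : ℕ}
    (f : ℝ → EuclideanSpace ℝ (Fin d) → EuclideanSpace ℝ (Fin d) → EuclideanSpace ℝ (Fin d))
    (τ : ℝ) (N j : ℕ) (y₀ : EuclideanSpace ℝ (Fin d)) (w : ℕ → EuclideanSpace ℝ (Fin d)) :
    ℕ → EuclideanSpace ℝ (Fin d)
  | 0 => y₀
  | k + 1 =>
      eulerOnInterval f τ N j y₀ w k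
        + (τ / (N : ℝ)) • f (gridPoint τ N j k) (eulerOnInterval f τ N j y₀ w k) (w k)

/-- The Euler scheme (method of steps) `y_k^j`, meaningful for `0 ≤ k ≤ N`: on the first interval
it starts from `η` with the delayed value `η`; on each later interval it starts from the last
value on the preceding interval and uses the values there as delayed values. -/
noncomputable def eulerDDE {d : ℕ}
    (f : ℝ → EuclideanSpace ℝ (Fin d) → EuclideanSpace ℝ (Fin d) → EuclideanSpace ℝ (Fin d))
    (τ : ℝ) (η : EuclideanSpace ℝ (Fin d)) (N : ℕ) : ℕ → ℕ → EuclideanSpace ℝ (Fin d)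
  | 0 => eulerOnInterval f τ N 0 η (fun _ => η)
  | j + 1 => eulerOnInterval f τ N (j + 1) (eulerDDE f τ η N j N) (eulerDDE f τ η N j)

/-! On each interval of length `τ` the delayed value is already known, so the equation there is an
ordinary one whose right-hand side has linear growth and is one-sided Lipschitz in `y`. For such
equations Grönwall's inequality for the squared distance shows that two approximate solutions differ
by at most a constant times the initial distance plus the defects
(`norm_sub_le_of_approx_solutions`). This single estimate does three jobs: Euler polygons form a
uniformly Cauchy sequence, which gives existence; two solutions have zero defect, which gives
uniqueness; and the Euler polygon of the scheme has a small defect, which gives the error bound.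

The defect is controlled by (F4): time contributes `h ^ α`, the motion of the polygon within one
step `h ^ β₁` and `h ^ β₂`, and the delayed argument `h ^ γ + e ^ γ`, where `e` is the error
inherited from the preceding interval (`DDEAssumptions.defect_le`). Hence the new error is at most a
multiple of `e + e ^ γ + h ^ min α γ + h ^ β₁ + h ^ β₂`; each interval multiplies the exponents by
`γ`, and `errorRate` solves this recursion. The constants are uniform in `f` because the a priori
bounds involve only `K`, `τ` and `‖η‖`. -/

/-! ### Stability under a one-sided Lipschitz condition -/

section OneSidedLipschitz

variable {E : Type*} [NormedAddCommGroup E] [InnerProductSpace ℝ E]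

/-- Grönwall's inequality under a bound on the inner product with the right derivative. -/
theorem norm_le_of_inner_deriv_right_le {e e' : ℝ → E} {a b Λ ε δ : ℝ} (hΛ : 0 ≤ Λ) (hε : 0 ≤ ε)
    (hc : ContinuousOn e (Set.Icc a b))
    (hd : ∀ t ∈ Set.Ico a b, HasDerivWithinAt e (e' t) (Set.Ici t) t) (ha : ‖e a‖ ≤ δ)
    (bound : ∀ t ∈ Set.Ico a b, inner ℝ (e t) (e' t) ≤ Λ * ‖e t‖ ^ 2 + ε * ‖e t‖) :
    ∀ t ∈ Set.Icc a b, ‖e t‖ ≤ (δ + ε) * Real.exp ((2 * Λ + 1) * (b - a)) := by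
  intro t ht
  have hδ : 0 ≤ δ := (norm_nonneg _).trans ha
  have hK : (2 * Λ + 1) ≠ 0 := by positivity
  -- The squared norm is differentiable even where `e` vanishes. Young's inequality `2 ε ‖e‖ ≤ ‖e‖ ^
  -- 2 + ε ^ 2` produces the rate `2 Λ + 1` and the forcing `ε ^ 2`.
  have key := le_gronwallBound_of_liminf_deriv_right_le (f := fun t => ‖e t‖ ^ 2)
    (f' := fun t => 2 * inner ℝ (e t) (e' t)) (δ := δ ^ 2) (K := 2 * Λ + 1) (ε := ε ^ 2)
    (a := a) (b := b) (hc.norm.pow 2)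
    (fun x hx r hr => (hd x hx).norm_sq.liminf_right_slope_le hr)
    (by gcongr) (fun x hx => by nlinarith [bound x hx, sq_nonneg (‖e x‖ - ε)]) t ht
  rw [gronwallBound_of_K_ne_0 hK] at key
  simp only at key
  have hta : 0 ≤ t - a := sub_nonneg.2 ht.1
  have h1 : Real.exp ((2 * Λ + 1) * (t - a)) ≤ Real.exp ((2 * Λ + 1) * (b - a)) := by
    gcongr
    exact ht.2
  have h0 : 1 ≤ Real.exp ((2 * Λ + 1) * (t - a)) := Real.one_le_exp (by positivity)
  set x := Real.exp ((2 * Λ + 1) * (t - a))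
  have h2 : ε ^ 2 / (2 * Λ + 1) * (x - 1) ≤ ε ^ 2 * (x - 1) := by
    have : ε ^ 2 / (2 * Λ + 1) ≤ ε ^ 2 := div_le_self (sq_nonneg _) (by linarith)
    exact mul_le_mul_of_nonneg_right this (by linarith)
  have h3 : ‖e t‖ ^ 2 ≤ ((δ + ε) * x) ^ 2 := by
    have h4 : ‖e t‖ ^ 2 ≤ (δ + ε) ^ 2 * x := by
      nlinarith [mul_nonneg hδ hε, mul_nonneg (mul_nonneg hδ hε) (by linarith : (0 : ℝ) ≤ x),
        sq_nonneg ε]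
    -- Since `1 ≤ x`, passing to `x ^ 2` gives a perfect square; the price is that the exponential
    -- rate is not halved by the root.
    have h5 : (δ + ε) ^ 2 * x ≤ (δ + ε) ^ 2 * x ^ 2 :=
      mul_le_mul_of_nonneg_left (by nlinarith) (sq_nonneg _)
    nlinarith
  have h4 : ‖e t‖ ≤ (δ + ε) * x := le_of_sq_le_sq h3 (by positivity)
  exact h4.trans (by gcongr)

/-- Two approximate solutions of an equation with one-sided Lipschitz right-hand side stay
close. -/
theorem norm_sub_le_of_approx_solutions {g : ℝ → E → E} {p q p' q' : ℝ → E}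
    {a b Λ ε₁ ε₂ δ : ℝ} (hΛ : 0 ≤ Λ)
    (hg : ∀ t ∈ Set.Ico a b, ∀ y₁ y₂,
      inner ℝ (y₁ - y₂) (g t y₁ - g t y₂) ≤ Λ * ‖y₁ - y₂‖ ^ 2)
    (hε₁ : 0 ≤ ε₁) (hε₂ : 0 ≤ ε₂)
    (hp : ContinuousOn p (Set.Icc a b)) (hq : ContinuousOn q (Set.Icc a b))
    (hp' : ∀ t ∈ Set.Ico a b, HasDerivWithinAt p (p' t) (Set.Ici t) t)
    (hq' : ∀ t ∈ Set.Ico a b, HasDerivWithinAt q (q' t) (Set.Ici t) t)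
    (hpε : ∀ t ∈ Set.Ico a b, ‖p' t - g t (p t)‖ ≤ ε₁)
    (hqε : ∀ t ∈ Set.Ico a b, ‖q' t - g t (q t)‖ ≤ ε₂)
    (ha : ‖p a - q a‖ ≤ δ) :
    ∀ t ∈ Set.Icc a b, ‖p t - q t‖ ≤ (δ + (ε₁ + ε₂)) * Real.exp ((2 * Λ + 1) * (b - a)) := by
  refine norm_le_of_inner_deriv_right_le (e := fun t => p t - q t) (e' := fun t => p' t - q' t)
    hΛ (add_nonneg hε₁ hε₂) (hp.sub hq) (fun t ht => (hp' t ht).sub (hq' t ht)) ha ?_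
  intro t ht
  have h1 : p' t - q' t = (g t (p t) - g t (q t))
      + ((p' t - g t (p t)) - (q' t - g t (q t))) := by abel
  rw [h1, inner_add_right]
  refine add_le_add (hg t ht _ _) ?_
  refine (real_inner_le_norm _ _).trans ?_
  rw [mul_comm]
  gcongr
  exact (norm_sub_le _ _).trans (add_le_add (hpε t ht) (hqε t ht))

end OneSidedLipschitz

/-! ### Euler polygons -/

section Polygon

variable {E : Type*} [NormedAddCommGroup E] [NormedSpace ℝ E]

/-- The polygon starting in `y₀` at time `a` with slope `v k` on `[a + k h, a + (k + 1) h]`,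
for `k < N`. -/
noncomputable def polygon (y₀ : E) (a h : ℝ) (N : ℕ) (v : ℕ → E) (t : ℝ) : E :=
  y₀ + ∑ k ∈ Finset.range N, max 0 (min (t - (a + k * h)) h) • v k

theorem continuous_polygon (y₀ : E) (a h : ℝ) (N : ℕ) (v : ℕ → E) :
    Continuous (polygon y₀ a h N v) := by
  unfold polygon
  fun_prop

/-- On the `m`-th segment the earlier truncated increments are saturated at `h`, the later ones are
cut off at `0`, and the saturated part telescopes to the vertex `y m`. -/
theorem polygon_eq {y v : ℕ → E} {a h : ℝ} (hh : 0 ≤ h) {N m : ℕ} (hm : m < N)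
    (hy : ∀ k < N, y (k + 1) = y k + h • v k) {t : ℝ}
    (ht : t ∈ Set.Icc (a + m * h) (a + (m + 1) * h)) :
    polygon (y 0) a h N v t = y m + (t - (a + m * h)) • v m := by
  have hsum : ∀ j ≤ N, y j = y 0 + ∑ k ∈ Finset.range j, h • v k := by
    intro j
    induction j with
    | zero => simp
    | succ j ih =>
      intro hj
      rw [hy j hj, ih (by omega), Finset.sum_range_succ, add_assoc]
  rw [polygon, hsum m hm.le, add_assoc]
  congr 1
  rw [← Finset.sum_subset (s₁ := Finset.range (m + 1)), Finset.sum_range_succ]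
  · congr 1
    · refine Finset.sum_congr rfl fun k hk => ?_
      have hk' : ((k : ℝ) + 1) ≤ m := by exact_mod_cast Finset.mem_range.1 hk
      have : h ≤ t - (a + k * h) := by nlinarith [ht.1]
      rw [min_eq_right this, max_eq_right hh]
    · rw [min_eq_left (by linarith [ht.2]), max_eq_right (by linarith [ht.1])]
  · intro k hk
    simp only [Finset.mem_range] at *
    omega
  · intro k _ hk
    have hk' : ((m : ℝ) + 1) ≤ k := by
      simp only [Finset.mem_range] at hk
      exact_mod_cast (by omega : m + 1 ≤ k)
    have : t - (a + k * h) ≤ 0 := by nlinarith [ht.2]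
    rw [max_eq_left ((min_le_left _ _).trans this), zero_smul]

theorem polygon_zero {y v : ℕ → E} {a h : ℝ} (hh : 0 ≤ h) {N : ℕ} (hN : 0 < N)
    (hy : ∀ k < N, y (k + 1) = y k + h • v k) : polygon (y 0) a h N v a = y 0 := by
  rw [polygon_eq hh hN hy (by constructor <;> simp [hh])]
  simp

theorem polygon_grid {y v : ℕ → E} {a h : ℝ} (hh : 0 ≤ h) {N m : ℕ} (hN : 0 < N) (hm : m ≤ N)
    (hy : ∀ k < N, y (k + 1) = y k + h • v k) : polygon (y 0) a h N v (a + m * h) = y m := by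
  cases m with
  | zero => simpa using polygon_zero (a := a) hh hN hy
  | succ m =>
    rw [polygon_eq hh hm hy (by constructor <;> push_cast <;> nlinarith), hy m hm]
    congr 2
    push_cast
    ring

/-- The Grönwall argument needs only right derivatives, so kinks are harmless: a node is assigned
the slope of the segment to its right. -/
theorem polygon_hasDerivWithinAt {y v : ℕ → E} {a h : ℝ} (hh : 0 < h) {N m : ℕ} (hm : m < N)
    (hy : ∀ k < N, y (k + 1) = y k + h • v k) {t : ℝ}
    (ht : t ∈ Set.Ico (a + m * h) (a + (m + 1) * h)) :
    HasDerivWithinAt (polygon (y 0) a h N v) (v m) (Set.Ici t) t := by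
  have h1 : HasDerivWithinAt (fun s => y m + (s - (a + m * h)) • v m) (v m) (Set.Ici t) t := by
    have := (((hasDerivWithinAt_id t (Set.Ici t)).sub_const (a + m * h)).smul_const
      (v m)).const_add (y m)
    simpa using this
  refine h1.congr_of_eventuallyEq ?_ (polygon_eq hh.le hm hy ⟨ht.1, ht.2.le⟩)
  have : Set.Icc t (a + (m + 1) * h) ∈ nhdsWithin t (Set.Ici t) := Icc_mem_nhdsGE ht.2
  filter_upwards [this] with s hs
  exact polygon_eq hh.le hm hy ⟨ht.1.trans hs.1, hs.2⟩

theorem exists_mem_grid_interval {a h : ℝ} (hh : 0 < h) {N : ℕ} {t : ℝ}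
    (ht : t ∈ Set.Ico a (a + N * h)) :
    ∃ m < N, t ∈ Set.Ico (a + m * h) (a + (m + 1) * h) := by
  have h0 : 0 ≤ (t - a) / h := div_nonneg (by linarith [ht.1]) hh.le
  refine ⟨⌊(t - a) / h⌋₊, ?_, ?_, ?_⟩
  · rw [Nat.floor_lt h0, div_lt_iff₀ hh]
    linarith [ht.2]
  · have := Nat.floor_le h0
    rw [le_div_iff₀ hh] at this
    linarith
  · have := Nat.lt_floor_add_one ((t - a) / h)
    rw [div_lt_iff₀ hh] at this
    linarith

/-- A point on a segment of the polygon is no larger than the vertices. -/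
theorem norm_polygon_segment_le {y w v : E} {h s R : ℝ} (hs : s ∈ Set.Icc 0 h)
    (hw : w = y + h • v) (hyR : ‖y‖ ≤ R) (hwR : ‖w‖ ≤ R) : ‖y + s • v‖ ≤ R := by
  rcases hs.1.eq_or_lt with h0 | h0
  · simpa [← h0] using hyR
  have hh : 0 < h := h0.trans_le hs.2
  have hconv := convex_closedBall (0 : E) R
  have : y + s • v = (1 - s / h) • y + (s / h) • w := by
    rw [hw, smul_add, smul_smul, div_mul_cancel₀ _ hh.ne', sub_smul, one_smul]
    abel
  rw [this, ← mem_closedBall_zero_iff]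
  exact hconv (by simpa using hyR) (by simpa using hwR)
    (sub_nonneg.2 ((div_le_one hh).2 hs.2)) (by positivity) (by ring)

/-- Discrete Grönwall: a step multiplies `1 + ‖y k‖` by at most `1 + G * h ≤ exp (G * h)`. -/
theorem euler_growth {y v : ℕ → E} {h G : ℝ} (hh : 0 ≤ h) (hG : 0 ≤ G) {N : ℕ}
    (hy : ∀ k < N, y (k + 1) = y k + h • v k) (hv : ∀ k < N, ‖v k‖ ≤ G * (1 + ‖y k‖)) :
    ∀ k ≤ N, ‖y k‖ ≤ (1 + ‖y 0‖) * Real.exp (G * (N * h)) := by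
  have key : ∀ k ≤ N, 1 + ‖y k‖ ≤ (1 + ‖y 0‖) * Real.exp (G * (k * h)) := by
    intro k
    induction k with
    | zero => simp
    | succ k ih =>
      intro hk
      have h1 := ih (by omega)
      have h2 : ‖y (k + 1)‖ ≤ ‖y k‖ + h * (G * (1 + ‖y k‖)) := by
        rw [hy k hk]
        refine (norm_add_le _ _).trans ?_
        rw [norm_smul, Real.norm_of_nonneg hh]
        gcongr
        exact hv k hk
      have h3 : 1 + G * h ≤ Real.exp (G * h) := by linarith [Real.add_one_le_exp (G * h)]
      calc 1 + ‖y (k + 1)‖ ≤ (1 + ‖y k‖) * (1 + G * h) := by linarith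
        _ ≤ ((1 + ‖y 0‖) * Real.exp (G * (k * h))) * Real.exp (G * h) := by gcongr
        _ = (1 + ‖y 0‖) * Real.exp (G * ((k + 1 : ℕ) * h)) := by
            rw [mul_assoc, ← Real.exp_add]
            push_cast
            ring_nf
  intro k hk
  have h1 : Real.exp (G * (k * h)) ≤ Real.exp (G * (N * h)) := by gcongr
  have h2 := key k hk
  nlinarith [norm_nonneg (y 0), mul_le_mul_of_nonneg_left h1 (by positivity : 0 ≤ 1 + ‖y 0‖)]

end Polygon

/-! ### Global existence for ordinary equations -/

section Existence

variable {E : Type*} [NormedAddCommGroup E]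

/-- Heine–Cantor on the compact set `[a, b]` times a closed ball. -/
theorem exists_uniform_modulus [ProperSpace E] {g : ℝ → E → E} {a b : ℝ}
    (hg : ContinuousOn (fun p : ℝ × E => g p.1 p.2) (Set.Icc a b ×ˢ Set.univ))
    (R : ℝ) {ε : ℝ} (hε : 0 < ε) :
    ∃ δ > 0, ∀ t ∈ Set.Icc a b, ∀ s ∈ Set.Icc a b, ∀ y z : E, ‖y‖ ≤ R → ‖z‖ ≤ R →
      |t - s| < δ → ‖y - z‖ < δ → ‖g t y - g s z‖ ≤ ε := by
  have hK : IsCompact (Set.Icc a b ×ˢ Metric.closedBall (0 : E) R) :=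
    isCompact_Icc.prod (isCompact_closedBall _ _)
  have hu := hK.uniformContinuousOn_of_continuous
    (hg.mono (Set.prod_mono subset_rfl (Set.subset_univ _)))
  obtain ⟨δ, hδ, h⟩ := Metric.uniformContinuousOn_iff.1 hu ε hε
  refine ⟨δ, hδ, fun t ht s hs y z hy hz hts hyz => ?_⟩
  have := h (t, y) ⟨ht, by simpa using hy⟩ (s, z) ⟨hs, by simpa using hz⟩
    (by rw [Prod.dist_eq, max_lt_iff]; exact ⟨hts, by rwa [dist_eq_norm]⟩)
  rw [dist_eq_norm] at this
  exact this.le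

/-- Euler polygons are approximate solutions. -/
theorem exists_approx_solution [NormedSpace ℝ E] [ProperSpace E] {g : ℝ → E → E} {a b G : ℝ} (hab : a < b)
    (hG : 0 ≤ G)
    (hg : ContinuousOn (fun p : ℝ × E => g p.1 p.2) (Set.Icc a b ×ˢ Set.univ))
    (hgrowth : ∀ t ∈ Set.Icc a b, ∀ y, ‖g t y‖ ≤ G * (1 + ‖y‖)) (y₀ : E) {ε : ℝ} (hε : 0 < ε) :
    ∃ p p' : ℝ → E, Continuous p ∧ p a = y₀ ∧
      (∀ t ∈ Set.Icc a b, ‖p t‖ ≤ (1 + ‖y₀‖) * Real.exp (G * (b - a))) ∧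
      (∀ t ∈ Set.Ico a b, HasDerivWithinAt p (p' t) (Set.Ici t) t) ∧
      (∀ t ∈ Set.Ico a b, ‖p' t - g t (p t)‖ ≤ ε) := by
  set R := (1 + ‖y₀‖) * Real.exp (G * (b - a)) with hR
  have hR0 : 0 ≤ R := by positivity
  obtain ⟨δ, hδ, hmod⟩ := exists_uniform_modulus hg R hε
  -- The first bound makes the step shorter than `δ`; the second makes the polygon, whose slopes are
  -- at most `G * (1 + R)`, move less than `δ` in one step.
  obtain ⟨N, hN⟩ := exists_nat_gt (max ((b - a) / δ) ((b - a) * (G * (1 + R)) / δ))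
  have hba : 0 < b - a := sub_pos.2 hab
  have hNR : (0 : ℝ) < N := lt_of_le_of_lt (by positivity) ((le_max_left _ _).trans_lt hN)
  have hN0 : 0 < N := by exact_mod_cast hNR
  set h := (b - a) / N with hh
  have hh0 : 0 < h := by positivity
  have hNh : N * h = b - a := by rw [hh]; field_simp
  have hhδ : h < δ := by
    have := (le_max_left _ _).trans_lt hN
    rw [div_lt_iff₀ hδ] at this
    rw [hh, div_lt_iff₀ hNR]
    linarith
  have hhVδ : h * (G * (1 + R)) < δ := by
    have := (le_max_right _ _).trans_lt hN
    rw [div_lt_iff₀ hδ] at this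
    rw [hh, div_mul_eq_mul_div, div_lt_iff₀ hNR]
    linarith
  obtain ⟨y, hy0, hy⟩ : ∃ y : ℕ → E, y 0 = y₀ ∧ ∀ k, y (k + 1) = y k + h • g (a + k * h) (y k) :=
    ⟨fun n => Nat.rec y₀ (fun k x => x + h • g (a + k * h) x) n, rfl, fun _ => rfl⟩
  have hmem : ∀ k ≤ N, a + k * h ∈ Set.Icc a b := by
    intro k hk
    have : (k : ℝ) * h ≤ N * h := by gcongr
    exact ⟨by simp only [le_add_iff_nonneg_right]; positivity, by linarith⟩
  have hyR : ∀ k ≤ N, ‖y k‖ ≤ R := by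
    intro k hk
    have := euler_growth hh0.le hG (fun k _ => hy k) (fun k hk => hgrowth _ (hmem k hk.le) _) k hk
    rwa [hNh, hy0] at this
  set v : ℕ → E := fun k => g (a + k * h) (y k) with hv
  have hseg : ∀ m < N, ∀ t ∈ Set.Icc (a + m * h) (a + (m + 1) * h),
      ‖polygon (y 0) a h N v t‖ ≤ R := by
    intro m hm t ht
    rw [polygon_eq hh0.le hm (fun k _ => hy k) ht]
    exact norm_polygon_segment_le ⟨by linarith [ht.1], by linarith [ht.2]⟩ (hy m) (hyR m hm.le)
      (hyR (m + 1) hm)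
  have hex : ∀ t ∈ Set.Ico a b, ∃ w, HasDerivWithinAt (polygon (y 0) a h N v) w (Set.Ici t) t ∧
      ‖polygon (y 0) a h N v t‖ ≤ R ∧ ‖w - g t (polygon (y 0) a h N v t)‖ ≤ ε := by
    intro t ht
    obtain ⟨m, hm, htm⟩ := exists_mem_grid_interval hh0 (N := N) (a := a) (t := t)
      (by rw [hNh]; simpa using ht)
    have htm' := Set.Ico_subset_Icc_self htm
    refine ⟨v m, polygon_hasDerivWithinAt hh0 hm (fun k _ => hy k) htm, hseg m hm t htm', ?_⟩
    refine hmod _ (hmem m hm.le) _ (Set.Ico_subset_Icc_self ht) _ _ (hyR m hm.le)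
      (hseg m hm t htm') ?_ ?_
    · rw [abs_sub_comm, abs_of_nonneg (by linarith [htm.1])]
      linarith [htm.2]
    · rw [polygon_eq hh0.le hm (fun k _ => hy k) htm', sub_add_cancel_left, norm_neg, norm_smul,
        Real.norm_of_nonneg (by linarith [htm.1])]
      refine lt_of_le_of_lt ?_ hhVδ
      have h1 : ‖v m‖ ≤ G * (1 + R) := by
        refine (hgrowth _ (hmem m hm.le) _).trans ?_
        gcongr
        exact hyR m hm.le
      gcongr
      linarith [htm.2]
  choose! p' hp'1 hp'2 hp'3 using hex
  refine ⟨polygon (y 0) a h N v, p', continuous_polygon _ _ _ _ _, ?_, ?_, hp'1, hp'3⟩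
  · rw [polygon_zero hh0.le hN0 (fun k _ => hy k), hy0]
  · intro t ht
    rcases ht.2.eq_or_lt with h1 | h1
    · have := polygon_grid (a := a) hh0.le hN0 le_rfl (fun k _ => hy k) (v := v)
      rw [hNh, add_sub_cancel] at this
      rw [h1, this]
      exact hyR N le_rfl
    · exact hp'2 t ⟨ht.1, h1⟩

/-- Peano's theorem for a right-hand side of linear growth that is one-sided Lipschitz, with
existence on the whole interval. -/
theorem exists_solution_of_one_sided_lipschitz [InnerProductSpace ℝ E] [ProperSpace E]
    {g : ℝ → E → E} {a b G Λ : ℝ}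
    (hab : a < b) (hG : 0 ≤ G) (hΛ : 0 ≤ Λ)
    (hg : ContinuousOn (fun p : ℝ × E => g p.1 p.2) (Set.Icc a b ×ˢ Set.univ))
    (hgrowth : ∀ t ∈ Set.Icc a b, ∀ y, ‖g t y‖ ≤ G * (1 + ‖y‖))
    (hlip : ∀ t ∈ Set.Ico a b, ∀ y₁ y₂,
      inner ℝ (y₁ - y₂) (g t y₁ - g t y₂) ≤ Λ * ‖y₁ - y₂‖ ^ 2) (y₀ : E) :
    ∃ z : ℝ → E, z a = y₀ ∧
      ∀ t ∈ Set.Icc a b, HasDerivWithinAt z (g t (z t)) (Set.Icc a b) t := by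
  set R := (1 + ‖y₀‖) * Real.exp (G * (b - a)) with hR
  set A := Real.exp ((2 * Λ + 1) * (b - a)) with hA
  have hA0 : 0 < A := Real.exp_pos _
  choose p p' hpc hpa hpR hpd hpε using fun n : ℕ =>
    exists_approx_solution hab hG hg hgrowth y₀ (Nat.one_div_pos_of_nat (α := ℝ) (n := n))
  -- Stability replaces the compactness argument of Peano: the whole sequence is uniformly Cauchy,
  -- with no subsequence needed.
  have hdist : ∀ m n, ∀ t ∈ Set.Icc a b,
      ‖p m t - p n t‖ ≤ (1 / ((m : ℝ) + 1) + 1 / ((n : ℝ) + 1)) * A := by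
    intro m n t ht
    have := norm_sub_le_of_approx_solutions (δ := 0) hΛ hlip Nat.one_div_pos_of_nat.le
      Nat.one_div_pos_of_nat.le (hpc m).continuousOn (hpc n).continuousOn (hpd m) (hpd n) (hpε m)
      (hpε n) (by simp [hpa]) t ht
    rwa [zero_add] at this
  have hlim0 : Filter.Tendsto (fun n : ℕ => 1 / ((n : ℝ) + 1)) Filter.atTop (nhds 0) :=
    tendsto_one_div_add_atTop_nhds_zero_nat
  have hcauchy : ∀ t ∈ Set.Icc a b, CauchySeq fun n => p n t := by
    intro t ht
    refine cauchySeq_of_le_tendsto_0 (fun n : ℕ => 2 * (1 / ((n : ℝ) + 1)) * A) ?_ ?_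
    · intro n m N hn hm
      rw [dist_eq_norm]
      refine (hdist n m t ht).trans ?_
      have h1 : 1 / ((n : ℝ) + 1) ≤ 1 / ((N : ℝ) + 1) := Nat.one_div_le_one_div hn
      have h2 : 1 / ((m : ℝ) + 1) ≤ 1 / ((N : ℝ) + 1) := Nat.one_div_le_one_div hm
      gcongr
      linarith
    · simpa using (hlim0.const_mul 2).mul_const A
  have hex : ∀ t ∈ Set.Icc a b, ∃ x, Filter.Tendsto (fun n => p n t) Filter.atTop (nhds x) :=
    fun t ht => cauchySeq_tendsto_of_complete (hcauchy t ht)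
  choose! z hz using hex
  have hpz : ∀ n, ∀ t ∈ Set.Icc a b, ‖p n t - z t‖ ≤ 1 / ((n : ℝ) + 1) * A := by
    intro n t ht
    have h1 : Filter.Tendsto (fun m => ‖p n t - p m t‖) Filter.atTop (nhds ‖p n t - z t‖) :=
      ((hz t ht).const_sub (p n t)).norm
    have h2 : Filter.Tendsto (fun m : ℕ => (1 / ((n : ℝ) + 1) + 1 / ((m : ℝ) + 1)) * A)
        Filter.atTop (nhds (1 / ((n : ℝ) + 1) * A)) := by
      simpa using (hlim0.const_add (1 / ((n : ℝ) + 1))).mul_const A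
    exact le_of_tendsto_of_tendsto' h1 h2 fun m => hdist n m t ht
  have hunif : TendstoUniformlyOn p z Filter.atTop (Set.Icc a b) := by
    rw [Metric.tendstoUniformlyOn_iff]
    intro ε hε
    have h1 : Filter.Tendsto (fun n : ℕ => 1 / ((n : ℝ) + 1) * A) Filter.atTop (nhds 0) := by
      simpa using hlim0.mul_const A
    filter_upwards [h1.eventually (gt_mem_nhds hε)] with n hn t ht
    rw [dist_comm, dist_eq_norm]
    exact (hpz n t ht).trans_lt hn
  have hzc : ContinuousOn z (Set.Icc a b) :=
    hunif.continuousOn (Filter.Frequently.of_forall fun n => (hpc n).continuousOn)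
  have hzR : ∀ t ∈ Set.Icc a b, ‖z t‖ ≤ R := fun t ht =>
    le_of_tendsto (hz t ht).norm (Filter.Eventually.of_forall fun n => hpR n t ht)
  have hφ : ContinuousOn (fun t => g t (z t)) (Set.Icc a b) :=
    hg.comp (continuousOn_id.prodMk hzc) fun t ht => ⟨ht, Set.mem_univ _⟩
  -- Constant extension beyond `[a, b]` makes the integral `w` differentiable at every real point,
  -- end points included.
  set φ : ℝ → E := Set.IccExtend hab.le ((Set.Icc a b).domRestrict fun t => g t (z t)) with hφdef
  have hφc : Continuous φ := (continuousOn_iff_continuous_domRestrict.1 hφ).Icc_extend'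
  have hφeq : ∀ t ∈ Set.Icc a b, φ t = g t (z t) := fun t ht => by
    rw [hφdef, Set.IccExtend_of_mem _ _ ht, Set.domRestrict_apply]
  set w : ℝ → E := fun t => y₀ + ∫ s in a..t, φ s with hw
  have hwd : ∀ t, HasDerivAt w (φ t) t := fun t =>
    (hφc.integral_hasStrictDerivAt a t).hasDerivAt.const_add y₀
  have hwz : ∀ t ∈ Set.Icc a b, w t = z t := by
    intro t ht
    have hpw : Filter.Tendsto (fun n => p n t) Filter.atTop (nhds (w t)) := by
      rw [Metric.tendsto_atTop']
      intro ε hε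
      have hba : 0 < b - a := sub_pos.2 hab
      have hη : 0 < ε / (4 * (b - a)) := by positivity
      obtain ⟨δ, hδ, hmod⟩ := exists_uniform_modulus hg R hη
      have h1 : Filter.Tendsto (fun n : ℕ => 1 / ((n : ℝ) + 1) * A) Filter.atTop (nhds 0) := by
        simpa using hlim0.mul_const A
      obtain ⟨M, hM⟩ := Filter.eventually_atTop.1
        ((h1.eventually (gt_mem_nhds hδ)).and (hlim0.eventually (gt_mem_nhds hη)))
      refine ⟨M, fun n hn => ?_⟩
      obtain ⟨hn1, hn2⟩ := hM n hn.le
      have := norm_image_sub_le_of_norm_deriv_right_le_segment (f := fun t => p n t - w t)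
        (f' := fun t => p' n t - φ t) (C := ε / (2 * (b - a))) (a := a) (b := b)
        ((hpc n).continuousOn.sub fun t _ => (hwd t).continuousAt.continuousWithinAt)
        (fun t ht => (hpd n t ht).sub (hwd t).hasDerivWithinAt) (fun s hs => by
          have hs' := Set.Ico_subset_Icc_self hs
          have h2 := hmod s hs' s hs' (p n s) (z s) (hpR n s hs') (hzR s hs') (by simpa using hδ)
            ((hpz n s hs').trans_lt hn1)
          have h3 := (hpε n s hs).trans hn2.le
          rw [hφeq s hs']
          have h4 : ε / (2 * (b - a)) = ε / (4 * (b - a)) + ε / (4 * (b - a)) := by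
            field_simp; norm_num
          rw [h4, ← sub_add_sub_cancel _ (g s (p n s))]
          exact norm_add_le_of_le h3 h2) t ht
      have hwa : p n a - w a = 0 := by simp [hw, hpa]
      rw [hwa, sub_zero] at this
      rw [dist_eq_norm]
      refine this.trans_lt ?_
      calc ε / (2 * (b - a)) * (t - a) ≤ ε / (2 * (b - a)) * (b - a) := by
            gcongr
            exact ht.2
        _ = ε / 2 := by field_simp
        _ < ε := by linarith
    exact tendsto_nhds_unique hpw (hz t ht)
  refine ⟨w, by simp [hw], fun t ht => ?_⟩
  rw [hwz t ht, ← hφeq t ht]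
  exact (hwd t).hasDerivWithinAt

end Existence

section DDE

variable {d : ℕ} {f : ℝ → EuclideanSpace ℝ (Fin d) → EuclideanSpace ℝ (Fin d) →
  EuclideanSpace ℝ (Fin d)} {K H L α β₁ β₂ γ : ℝ}

theorem DDEAssumptions.growth (hf : DDEAssumptions f K H L α β₁ β₂ γ) (hK : 0 ≤ K) {t D : ℝ}
    (ht : 0 ≤ t) {z : EuclideanSpace ℝ (Fin d)} (hz : ‖z‖ ≤ D) (y : EuclideanSpace ℝ (Fin d)) :
    ‖f t y z‖ ≤ K * (1 + D) * (1 + ‖y‖) :=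
  calc ‖f t y z‖ ≤ K * (1 + ‖y‖) * (1 + ‖z‖) := hf.F2 t ht y z
    _ ≤ K * (1 + ‖y‖) * (1 + D) := by gcongr
    _ = K * (1 + D) * (1 + ‖y‖) := by ring

theorem DDEAssumptions.one_sided (hf : DDEAssumptions f K H L α β₁ β₂ γ) {t D : ℝ}
    (ht : 0 ≤ t) {z : EuclideanSpace ℝ (Fin d)} (hz : ‖z‖ ≤ D)
    (y₁ y₂ : EuclideanSpace ℝ (Fin d)) :
    inner ℝ (y₁ - y₂) (f t y₁ z - f t y₂ z) ≤ max H 0 * (1 + D) * ‖y₁ - y₂‖ ^ 2 := by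
  refine (hf.F3 t ht z y₁ y₂).trans ?_
  gcongr
  exact le_max_left _ _

theorem continuousOn_of_history_of_hasDerivWithinAt {E : Type*} [NormedAddCommGroup E]
    [NormedSpace ℝ E] {z z' : ℝ → E} {η : E} {τ T : ℝ} (hτ : 0 ≤ τ) (hT : 0 ≤ T)
    (hist : ∀ t ∈ Set.Icc (-τ) 0, z t = η)
    (hd : ∀ t ∈ Set.Icc 0 T, HasDerivWithinAt z (z' t) (Set.Icc 0 T) t) :
    ContinuousOn z (Set.Icc (-τ) T) := by
  have h1 : ContinuousOn z (Set.Icc (-τ) 0) :=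
    (continuousOn_const (c := η)).congr hist
  have h2 : ContinuousOn z (Set.Icc 0 T) := fun t ht => (hd t ht).continuousWithinAt
  have h3 := h1.union_of_isClosed h2 isClosed_Icc isClosed_Icc
  rwa [Set.Icc_union_Icc_eq_Icc (by linarith) hT] at h3

/-- Method of steps: solutions on `[-τ, m τ]` exist for every `m`. -/
theorem DDEAssumptions.exists_solution_steps (hf : DDEAssumptions f K H L α β₁ β₂ γ)
    (hK : 0 ≤ K) {τ : ℝ} (hτ : 0 < τ) (η : EuclideanSpace ℝ (Fin d)) (m : ℕ) :
    ∃ z : ℝ → EuclideanSpace ℝ (Fin d), (∀ t ∈ Set.Icc (-τ) 0, z t = η) ∧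
      ∀ t ∈ Set.Icc 0 ((m : ℝ) * τ),
        HasDerivWithinAt z (f t (z t) (z (t - τ))) (Set.Icc 0 ((m : ℝ) * τ)) t := by
  induction m with
  | zero =>
    refine ⟨fun _ => η, fun _ _ => rfl, fun t ht => ?_⟩
    simp only [Nat.cast_zero, zero_mul, Set.Icc_self, Set.mem_singleton_iff] at ht ⊢
    subst ht
    exact hasDerivWithinAt_iff_hasFDerivWithinAt.2 .singleton
  | succ m ih =>
    obtain ⟨z, hist, hd⟩ := ih
    set a : ℝ := (m : ℝ) * τ with ha
    have hb : ((m + 1 : ℕ) : ℝ) * τ = a + τ := by push_cast; ring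
    rw [hb]
    have ha0 : 0 ≤ a := by positivity
    have hzc := continuousOn_of_history_of_hasDerivWithinAt hτ.le ha0 hist hd
    have hζc : ContinuousOn (fun t => z (t - τ)) (Set.Icc a (a + τ)) :=
      hzc.comp (by fun_prop) fun t ht => ⟨by linarith [ht.1], by linarith [ht.2]⟩
    obtain ⟨D, hD⟩ := isCompact_Icc.exists_bound_of_continuousOn hζc
    have hD0 : 0 ≤ D := (norm_nonneg _).trans (hD a ⟨le_rfl, by linarith⟩)
    obtain ⟨w, hwa, hwd⟩ := exists_solution_of_one_sided_lipschitz
      (g := fun t y => f t y (z (t - τ))) (a := a) (b := a + τ) (G := K * (1 + D))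
      (Λ := max H 0 * (1 + D)) (by linarith) (by positivity) (by positivity)
      (hf.F1.comp (continuousOn_fst.prodMk (continuousOn_snd.prodMk
        (hζc.comp continuousOn_fst fun p hp => hp.1)))
        fun p hp => ⟨ha0.trans hp.1.1, Set.mem_univ _⟩)
      (fun t ht y => hf.growth hK (ha0.trans ht.1) (hD t ht) y)
      (fun t ht y₁ y₂ => hf.one_sided (ha0.trans ht.1) (hD t (Set.Ico_subset_Icc_self ht)) y₁ y₂)
      (z a)
    set u : ℝ → EuclideanSpace ℝ (Fin d) := fun t => if t ≤ a then z t else w t with hu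
    have huz : ∀ t ≤ a, u t = z t := fun t ht => if_pos ht
    have huw : ∀ t, a ≤ t → u t = w t := fun t ht => by
      rcases ht.eq_or_lt with h | h
      · rw [← h, huz a le_rfl, hwa]
      · exact if_neg h.not_ge
    refine ⟨u, fun t ht => (huz t (ht.2.trans ha0)).trans (hist t ht), fun t ht => ?_⟩
    rw [huz (t - τ) (by linarith [ht.2]), ← Set.Icc_union_Icc_eq_Icc ha0 (by linarith : a ≤ a + τ)]
    refine HasDerivWithinAt.union ?_ ?_
    · by_cases hta : t ≤ a
      · rw [huz t hta]
        exact (hd t ⟨ht.1, hta⟩).congr (fun s hs => huz s hs.2) (huz t hta)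
      · refine hasDerivWithinAt_iff_hasFDerivWithinAt.2 (.of_notMem_closure ?_)
        simp [isClosed_Icc.closure_eq, hta]
    · by_cases hta : a ≤ t
      · rw [huw t hta]
        exact (hwd t ⟨hta, ht.2⟩).congr (fun s hs => huw s hs.1) (huw t hta)
      · refine hasDerivWithinAt_iff_hasFDerivWithinAt.2 (.of_notMem_closure ?_)
        simp [isClosed_Icc.closure_eq, hta]

theorem DDEAssumptions.exists_solution (hf : DDEAssumptions f K H L α β₁ β₂ γ)
    (hK : 0 ≤ K) {τ : ℝ} (hτ : 0 < τ) (η : EuclideanSpace ℝ (Fin d)) (n : ℕ) :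
    ∃ z, IsDDESolution f τ η n z := by
  obtain ⟨z, h1, h2⟩ := hf.exists_solution_steps hK hτ η (n + 1)
  rw [Nat.cast_succ] at h2
  exact ⟨z, h1, h2⟩

/-- A bound, uniform in the right-hand side, for the solution on `[-τ, j τ]` and for the Euler
scheme on the first `j` intervals. -/
noncomputable def aprioriBound (K τ x : ℝ) : ℕ → ℝ
  | 0 => x
  | j + 1 => (1 + aprioriBound K τ x j) * Real.exp (K * (1 + aprioriBound K τ x j) * τ)

theorem aprioriBound_nonneg {K τ x : ℝ} (hx : 0 ≤ x) (j : ℕ) : 0 ≤ aprioriBound K τ x j := by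
  induction j with
  | zero => exact hx
  | succ j ih => rw [aprioriBound]; positivity

theorem aprioriBound_le_succ {K τ x : ℝ} (hK : 0 ≤ K) (hτ : 0 ≤ τ) (hx : 0 ≤ x) (j : ℕ) :
    aprioriBound K τ x j ≤ aprioriBound K τ x (j + 1) := by
  have h0 := aprioriBound_nonneg (K := K) (τ := τ) hx j
  rw [aprioriBound]
  have : 1 ≤ Real.exp (K * (1 + aprioriBound K τ x j) * τ) := Real.one_le_exp (by positivity)
  nlinarith

namespace IsDDESolution

variable {τ : ℝ} {η : EuclideanSpace ℝ (Fin d)} {n : ℕ} {z : ℝ → EuclideanSpace ℝ (Fin d)}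

theorem continuousOn (hz : IsDDESolution f τ η n z) (hτ : 0 ≤ τ) :
    ContinuousOn z (Set.Icc (-τ) (((n : ℝ) + 1) * τ)) :=
  continuousOn_of_history_of_hasDerivWithinAt hτ (by positivity) hz.history hz.deriv_eq

theorem hasDerivWithinAt_Ici (hz : IsDDESolution f τ η n z) {t : ℝ}
    (ht : t ∈ Set.Ico 0 (((n : ℝ) + 1) * τ)) :
    HasDerivWithinAt z (f t (z t) (z (t - τ))) (Set.Ici t) t :=
  (hz.deriv_eq t (Set.Ico_subset_Icc_self ht)).mono_of_mem_nhdsWithin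
    (Filter.mem_of_superset (Icc_mem_nhdsGE ht.2) (Set.Icc_subset_Icc_left ht.1))

theorem step_le (hτ : 0 ≤ τ) {j : ℕ} (hj : j ≤ n) :
    (j : ℝ) * τ + τ ≤ ((n : ℝ) + 1) * τ := by
  have : (j : ℝ) ≤ n := by exact_mod_cast hj
  nlinarith

theorem norm_le (hf : DDEAssumptions f K H L α β₁ β₂ γ) (hK : 0 < K) (hτ : 0 < τ)
    (hz : IsDDESolution f τ η n z) {j : ℕ} (hj : j ≤ n + 1) :
    ∀ t ∈ Set.Icc (-τ) ((j : ℝ) * τ), ‖z t‖ ≤ aprioriBound K τ ‖η‖ j := by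
  induction j with
  | zero =>
    intro t ht
    rw [hz.history t (by simpa using ht), aprioriBound]
  | succ j ih =>
    have ih := ih (by omega)
    set D := aprioriBound K τ ‖η‖ j with hD
    have hD0 : 0 ≤ D := aprioriBound_nonneg (norm_nonneg _) j
    have hjn := step_le hτ.le (by omega : j ≤ n)
    have hj0 : 0 ≤ (j : ℝ) * τ := by positivity
    intro t ht
    have htle : t ≤ (j : ℝ) * τ + τ := by
      have := ht.2
      push_cast at this
      linarith
    rcases le_total t ((j : ℝ) * τ) with h | h
    · exact (ih t ⟨ht.1, h⟩).trans (aprioriBound_le_succ hK.le hτ.le (norm_nonneg _) j)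
    have hG : 0 < K * (1 + D) := by positivity
    have := norm_le_gronwallBound_of_norm_deriv_right_le (f := z) (δ := D) (K := K * (1 + D))
      (ε := K * (1 + D)) (a := j * τ) (b := j * τ + τ)
      ((hz.continuousOn hτ.le).mono (Set.Icc_subset_Icc (by linarith) hjn))
      (fun s hs => hz.hasDerivWithinAt_Ici ⟨hj0.trans hs.1, hs.2.trans_le hjn⟩)
      (ih _ ⟨by linarith, le_rfl⟩) (fun s hs => by
        have := hf.growth hK.le (hj0.trans hs.1)
          (ih (s - τ) ⟨by linarith [hs.1], by linarith [hs.2]⟩) (z s)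
        linarith) t ⟨h, htle⟩
    rw [gronwallBound_of_K_ne_0 hG.ne'] at this
    simp only [div_self hG.ne', one_mul] at this
    rw [aprioriBound, ← hD]
    have h2 : Real.exp (K * (1 + D) * (t - j * τ)) ≤ Real.exp (K * (1 + D) * τ) := by
      gcongr
      linarith
    calc ‖z t‖ ≤ (1 + D) * Real.exp (K * (1 + D) * (t - j * τ)) := by linarith
      _ ≤ (1 + D) * Real.exp (K * (1 + D) * τ) := by gcongr

theorem norm_sub_le (hf : DDEAssumptions f K H L α β₁ β₂ γ) (hK : 0 < K) (hτ : 0 < τ)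
    (hz : IsDDESolution f τ η n z) {j : ℕ} (hj : j ≤ n + 1) {s t : ℝ} (hs : -τ ≤ s)
    (hst : s ≤ t) (ht : t ≤ (j : ℝ) * τ) :
    ‖z t - z s‖ ≤ K * (1 + aprioriBound K τ ‖η‖ j) * (1 + aprioriBound K τ ‖η‖ j)
      * (t - s) := by
  set D := aprioriBound K τ ‖η‖ j with hD
  have hD0 : 0 ≤ D := aprioriBound_nonneg (norm_nonneg _) j
  have hjn : (j : ℝ) * τ ≤ ((n : ℝ) + 1) * τ := by
    gcongr
    exact_mod_cast hj
  refine norm_image_sub_le_of_norm_deriv_right_le_segment (f := z)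
    (f' := fun t => if t < 0 then 0 else f t (z t) (z (t - τ))) (a := s) (b := t)
    ((hz.continuousOn hτ.le).mono (Set.Icc_subset_Icc hs (ht.trans hjn))) ?_ ?_ t ⟨hst, le_rfl⟩
  · intro x hx
    split_ifs with h
    · refine (hasDerivWithinAt_const x (Set.Ici x) η).congr_of_eventuallyEq ?_
        (hz.history x ⟨hs.trans hx.1, h.le⟩)
      filter_upwards [Icc_mem_nhdsGE h] with r hr
      exact hz.history r ⟨hs.trans (hx.1.trans hr.1), hr.2⟩
    · exact hz.hasDerivWithinAt_Ici ⟨not_lt.1 h, (hx.2.trans_le ht).trans_le hjn⟩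
  · intro x hx
    split_ifs with h
    · rw [norm_zero]
      positivity
    · have hx0 := not_lt.1 h
      have hb := hz.norm_le hf hK hτ hj
      refine (hf.growth hK.le hx0 (hb (x - τ) ⟨by linarith, by linarith [hx.2]⟩) _).trans ?_
      gcongr
      exact hb x ⟨by linarith, by linarith [hx.2]⟩

theorem eqOn (hf : DDEAssumptions f K H L α β₁ β₂ γ) (hK : 0 < K) (hτ : 0 < τ)
    (hz : IsDDESolution f τ η n z) {w : ℝ → EuclideanSpace ℝ (Fin d)}
    (hw : IsDDESolution f τ η n w) : Set.EqOn w z (Set.Icc (-τ) (((n : ℝ) + 1) * τ)) := by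
  have key : ∀ j ≤ n + 1, Set.EqOn w z (Set.Icc (-τ) ((j : ℝ) * τ)) := by
    intro j
    induction j with
    | zero =>
      intro _ t ht
      have ht' : t ∈ Set.Icc (-τ) 0 := by simpa using ht
      rw [hz.history t ht', hw.history t ht']
    | succ j ih =>
      intro hj t ht
      have ih := ih (by omega)
      have hjn := step_le hτ.le (by omega : j ≤ n)
      have hj0 : 0 ≤ (j : ℝ) * τ := by positivity
      have htle : t ≤ (j : ℝ) * τ + τ := by
        have := ht.2
        push_cast at this
        linarith
      rcases le_total t ((j : ℝ) * τ) with h | h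
      · exact ih ⟨ht.1, h⟩
      have hb := hz.norm_le hf hK hτ (by omega : j ≤ n + 1)
      have := aprioriBound_nonneg (K := K) (τ := τ) (norm_nonneg η) j
      have hsub := Set.Icc_subset_Icc (by linarith : -τ ≤ j * τ) hjn
      have h1 := norm_sub_le_of_approx_solutions (g := fun t y => f t y (z (t - τ)))
        (p := w) (q := z) (a := j * τ) (b := j * τ + τ) (ε₁ := 0) (ε₂ := 0) (δ := 0)
        (Λ := max H 0 * (1 + aprioriBound K τ ‖η‖ j)) (by positivity)
        (fun s hs y₁ y₂ => hf.one_sided (hj0.trans hs.1)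
          (hb (s - τ) ⟨by linarith [hs.1], by linarith [hs.2]⟩) y₁ y₂) le_rfl le_rfl
        ((hw.continuousOn hτ.le).mono hsub) ((hz.continuousOn hτ.le).mono hsub)
        (fun s hs => hw.hasDerivWithinAt_Ici ⟨hj0.trans hs.1, hs.2.trans_le hjn⟩)
        (fun s hs => hz.hasDerivWithinAt_Ici ⟨hj0.trans hs.1, hs.2.trans_le hjn⟩)
        (fun s hs => by
          rw [ih (show s - τ ∈ _ from ⟨by linarith [hs.1], by linarith [hs.2]⟩), sub_self,
            norm_zero])
        (fun s hs => by rw [sub_self, norm_zero])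
        (by rw [ih (show (j : ℝ) * τ ∈ _ from ⟨by linarith, le_rfl⟩), sub_self, norm_zero])
        t ⟨h, htle⟩
      simp only [add_zero, zero_mul, norm_le_zero_iff] at h1
      exact sub_eq_zero.1 h1
  have := key (n + 1) le_rfl
  rwa [Nat.cast_succ] at this

end IsDDESolution

end DDE

section Rates

theorem rpow_add_le_rpow_add_rpow {x y p : ℝ} (hx : 0 ≤ x) (hy : 0 ≤ y) (hp : 0 ≤ p)
    (hp1 : p ≤ 1) : (x + y) ^ p ≤ x ^ p + y ^ p := by
  lift x to NNReal using hx
  lift y to NNReal using hy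
  exact_mod_cast NNReal.rpow_add_le_add_rpow x y hp hp1

theorem mul_rpow_le_one_add_mul_rpow {c x p : ℝ} (hc : 0 ≤ c) (hx : 0 ≤ x) (hp : 0 ≤ p)
    (hp1 : p ≤ 1) : (c * x) ^ p ≤ (1 + c) * x ^ p := by
  rw [Real.mul_rpow hc hx]
  gcongr
  calc c ^ p ≤ (1 + c) ^ p := by gcongr; linarith
    _ ≤ (1 + c) ^ (1 : ℝ) := Real.rpow_le_rpow_of_exponent_le (by linarith) hp1
    _ = 1 + c := Real.rpow_one _

/-- The rate of convergence of the Euler scheme on the `j`-th interval. -/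
noncomputable def errorRate (α β₁ β₂ γ h : ℝ) (j : ℕ) : ℝ :=
  h ^ (γ ^ j * min α γ) + h ^ (β₁ * γ ^ j) + h ^ (β₂ * γ ^ j)

variable {α β₁ β₂ γ h : ℝ}

theorem errorRate_nonneg (hh : 0 ≤ h) (j : ℕ) : 0 ≤ errorRate α β₁ β₂ γ h j := by
  rw [errorRate]
  positivity

theorem errorRate_mono (hα : 0 ≤ α) (hβ₁ : 0 ≤ β₁) (hβ₂ : 0 ≤ β₂) (hγ : 0 ≤ γ) (hγ1 : γ ≤ 1)
    (hh : 0 < h) (hh1 : h ≤ 1) : Monotone (errorRate α β₁ β₂ γ h) := by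
  intro i j hij
  have hpow : γ ^ j ≤ γ ^ i := pow_le_pow_of_le_one hγ hγ1 hij
  have hmin : 0 ≤ min α γ := le_min hα hγ
  unfold errorRate
  gcongr ?_ + ?_ + ?_ <;> refine Real.rpow_le_rpow_of_exponent_ge hh hh1 ?_ <;> gcongr

theorem errorRate_rpow_le (hγ : 0 ≤ γ) (hγ1 : γ ≤ 1) (hh : 0 ≤ h) (j : ℕ) :
    errorRate α β₁ β₂ γ h j ^ γ ≤ errorRate α β₁ β₂ γ h (j + 1) := by
  unfold errorRate
  refine (rpow_add_le_rpow_add_rpow (by positivity) (by positivity) hγ hγ1).trans ?_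
  refine (add_le_add_left
    (rpow_add_le_rpow_add_rpow (by positivity) (by positivity) hγ hγ1) _).trans ?_
  rw [← Real.rpow_mul hh, ← Real.rpow_mul hh, ← Real.rpow_mul hh]
  apply le_of_eq
  congr 2
  · congr 1
    ring_nf
  · ring_nf
  · ring_nf

theorem error_add_rpow_add_errorRate_le (hα : 0 ≤ α) (hβ₁ : 0 ≤ β₁) (hβ₂ : 0 ≤ β₂) (hγ : 0 ≤ γ)
    (hγ1 : γ ≤ 1) (hh : 0 < h) (hh1 : h ≤ 1) {C : ℝ} (hC : 0 ≤ C) (j : ℕ) :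
    C * errorRate α β₁ β₂ γ h j + (C * errorRate α β₁ β₂ γ h j) ^ γ + errorRate α β₁ β₂ γ h 0
      ≤ (2 * C + 2) * errorRate α β₁ β₂ γ h (j + 1) := by
  have hmono := errorRate_mono hα hβ₁ hβ₂ hγ hγ1 hh hh1
  have h0 := errorRate_nonneg (α := α) (β₁ := β₁) (β₂ := β₂) (γ := γ) hh.le j
  have h1 := mul_le_mul_of_nonneg_left (hmono j.le_succ) hC
  have h2 := hmono (j + 1).zero_le
  have h3 := (mul_rpow_le_one_add_mul_rpow hC h0 hγ hγ1).trans
    (mul_le_mul_of_nonneg_left (errorRate_rpow_le (α := α) (β₁ := β₁) (β₂ := β₂) hγ hγ1 hh.le j)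
      (by linarith))
  simp only [Nat.succ_eq_add_one] at h1
  linarith

end Rates

section EulerError

variable {d : ℕ} {f : ℝ → EuclideanSpace ℝ (Fin d) → EuclideanSpace ℝ (Fin d) →
  EuclideanSpace ℝ (Fin d)} {K H L α β₁ β₂ γ : ℝ}

/-- The defect of a segment of the Euler polygon. -/
theorem DDEAssumptions.defect_le (hf : DDEAssumptions f K H L α β₁ β₂ γ) (hL : 0 ≤ L)
    (hα : α ∈ Set.Ioc (0 : ℝ) 1) (hβ₁ : β₁ ∈ Set.Ioc (0 : ℝ) 1) (hβ₂ : β₂ ∈ Set.Ioc (0 : ℝ) 1)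
    (hγ : γ ∈ Set.Ioc (0 : ℝ) 1) {D R V W e h s t : ℝ} (hV : 0 ≤ V) (hW : 0 ≤ W) (he : 0 ≤ e)
    (hh : 0 < h)
    (hh1 : h ≤ 1) (hs : 0 ≤ s) (hst : s ≤ t) (hts : t ≤ s + h)
    {y p w ζ : EuclideanSpace ℝ (Fin d)} (hy : ‖y‖ ≤ R) (hp : ‖p‖ ≤ R) (hw : ‖w‖ ≤ D)
    (hζ : ‖ζ‖ ≤ D) (hyp : ‖y - p‖ ≤ W * h) (hwζ : ‖w - ζ‖ ≤ V * h + e) :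
    ‖f s y w - f t p ζ‖ ≤ L * ((1 + 2 * R) * (1 + 2 * D) * (1 + W) * (2 + V))
      * (e ^ γ + errorRate α β₁ β₂ γ h 0) := by
  have hD : 0 ≤ D := (norm_nonneg _).trans hw
  have hR : 0 ≤ R := (norm_nonneg _).trans hy
  have hm : ∀ x, min α γ ≤ x → h ^ x ≤ h ^ min α γ := fun x hx =>
    Real.rpow_le_rpow_of_exponent_ge hh hh1 hx
  have htime : |s - t| ^ α ≤ h ^ min α γ := by
    refine le_trans ?_ (hm α (min_le_left _ _))
    refine Real.rpow_le_rpow (abs_nonneg _) ?_ hα.1.le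
    rw [abs_sub_comm, abs_of_nonneg (by linarith)]
    linarith
  have hspace : ∀ β ∈ Set.Ioc (0 : ℝ) 1, ‖y - p‖ ^ β ≤ (1 + W) * h ^ β := fun β hβ =>
    (Real.rpow_le_rpow (norm_nonneg _) hyp hβ.1.le).trans
      (mul_rpow_le_one_add_mul_rpow hW hh.le hβ.1.le hβ.2)
  have hdelay : ‖w - ζ‖ ^ γ ≤ (1 + V) * h ^ min α γ + e ^ γ := by
    refine (Real.rpow_le_rpow (norm_nonneg _) hwζ hγ.1.le).trans ?_
    refine (rpow_add_le_rpow_add_rpow (by positivity) he hγ.1.le hγ.2).trans ?_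
    gcongr
    refine (mul_rpow_le_one_add_mul_rpow hV hh.le hγ.1.le hγ.2).trans ?_
    exact mul_le_mul_of_nonneg_left (hm γ (min_le_right _ _)) (by linarith)
  have hP₁ : 1 + ‖y‖ + ‖p‖ ≤ 1 + 2 * R := by linarith
  have hP₂ : 1 + ‖w‖ + ‖ζ‖ ≤ 1 + 2 * D := by linarith
  refine (hf.F4 s t hs (hs.trans hst) y p w ζ).trans ?_
  rw [mul_assoc L]
  refine mul_le_mul_of_nonneg_left ?_ hL
  have hS : errorRate α β₁ β₂ γ h 0 = h ^ min α γ + h ^ β₁ + h ^ β₂ := by simp [errorRate]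
  rw [hS]
  have hm0 : 0 ≤ h ^ min α γ := by positivity
  have hb₁ : 0 ≤ h ^ β₁ := by positivity
  have hb₂ : 0 ≤ h ^ β₂ := by positivity
  have he0 : 0 ≤ e ^ γ := by positivity
  set P₁ := 1 + 2 * R with hP₁'
  set P₂ := 1 + 2 * D with hP₂'
  have h1 : 1 ≤ P₁ := by linarith
  have h2 : 1 ≤ P₂ := by linarith
  set P := P₁ * P₂ * (1 + W) with hP
  have hP0 : 0 ≤ P := by positivity
  have e1 : P₁ * P₂ ≤ P := le_mul_of_one_le_right (by positivity) (by linarith)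
  have e2 : P₂ * (1 + W) ≤ P := by
    rw [hP, mul_assoc]
    exact le_mul_of_one_le_left (by positivity) h1
  have e3 : P₁ ≤ P := (le_mul_of_one_le_right (by positivity) h2).trans e1
  calc _ ≤ P₁ * P₂ * h ^ min α γ + P₂ * ((1 + W) * h ^ β₁) + P₂ * ((1 + W) * h ^ β₂)
        + P₁ * ((1 + V) * h ^ min α γ + e ^ γ) := by
        gcongr
        · exact hspace β₁ hβ₁
        · exact hspace β₂ hβ₂
    _ ≤ P * h ^ min α γ + P * h ^ β₁ + P * h ^ β₂
        + P * ((1 + V) * h ^ min α γ + e ^ γ) := by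
        rw [← mul_assoc P₂, ← mul_assoc P₂]
        gcongr
    _ ≤ P * (2 + V) * (e ^ γ + (h ^ min α γ + h ^ β₁ + h ^ β₂)) := by
        nlinarith [mul_nonneg hP0 he0, mul_nonneg hP0 hb₁, mul_nonneg hP0 hb₂,
          mul_nonneg (mul_nonneg hP0 hV) he0, mul_nonneg (mul_nonneg hP0 hV) hb₁,
          mul_nonneg (mul_nonneg hP0 hV) hb₂]

/-- Error of the Euler scheme on one interval, in terms of the error `e` of the initial and
delayed values. -/
theorem DDEAssumptions.euler_error_interval (hf : DDEAssumptions f K H L α β₁ β₂ γ) (hK : 0 ≤ K)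
    (hL : 0 ≤ L)
    (hα : α ∈ Set.Ioc (0 : ℝ) 1) (hβ₁ : β₁ ∈ Set.Ioc (0 : ℝ) 1) (hβ₂ : β₂ ∈ Set.Ioc (0 : ℝ) 1)
    (hγ : γ ∈ Set.Ioc (0 : ℝ) 1) {D R V e h a τ : ℝ} (hV : 0 ≤ V) (he : 0 ≤ e) (hh : 0 < h)
    (hh1 : h ≤ 1) (ha : 0 ≤ a) {N : ℕ} (hN : 0 < N) (hNh : N * h = τ)
    {z ζ : ℝ → EuclideanSpace ℝ (Fin d)} {y w : ℕ → EuclideanSpace ℝ (Fin d)}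
    (hz : ContinuousOn z (Set.Icc a (a + τ)))
    (hz' : ∀ t ∈ Set.Ico a (a + τ), HasDerivWithinAt z (f t (z t) (ζ t)) (Set.Ici t) t)
    (hζD : ∀ t ∈ Set.Icc a (a + τ), ‖ζ t‖ ≤ D)
    (hζV : ∀ s t, a ≤ s → s ≤ t → t ≤ a + τ → ‖ζ t - ζ s‖ ≤ V * (t - s))
    (hwD : ∀ k ≤ N, ‖w k‖ ≤ D) (hwe : ∀ k ≤ N, ‖ζ (a + k * h) - w k‖ ≤ e)
    (hyR : ∀ k ≤ N, ‖y k‖ ≤ R) (hy : ∀ k, y (k + 1) = y k + h • f (a + k * h) (y k) (w k))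
    (h0 : ‖z a - y 0‖ ≤ e) :
    ∀ k ≤ N, ‖z (a + k * h) - y k‖ ≤
      (1 + L * ((1 + 2 * R) * (1 + 2 * D) * (1 + K * (1 + D) * (1 + R)) * (2 + V)))
        * Real.exp ((2 * (max H 0 * (1 + D)) + 1) * τ)
        * (e + e ^ γ + errorRate α β₁ β₂ γ h 0) := by
  have hD : 0 ≤ D := (norm_nonneg _).trans (hwD 0 N.zero_le)
  have hR : 0 ≤ R := (norm_nonneg _).trans (hyR 0 N.zero_le)
  set W := K * (1 + D) * (1 + R) with hW
  have hW0 : 0 ≤ W := by positivity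
  set B := L * ((1 + 2 * R) * (1 + 2 * D) * (1 + W) * (2 + V)) with hB
  have hB0 : 0 ≤ B := by positivity
  set S := errorRate α β₁ β₂ γ h 0 with hS
  have hS0 : 0 ≤ S := errorRate_nonneg hh.le 0
  set v : ℕ → EuclideanSpace ℝ (Fin d) := fun k => f (a + k * h) (y k) (w k) with hv
  have hyv : ∀ k < N, y (k + 1) = y k + h • v k := fun k _ => hy k
  have hgrid : ∀ k ≤ N, a + k * h ∈ Set.Icc a (a + τ) := by
    intro k hk
    have : (k : ℝ) * h ≤ N * h := by gcongr
    exact ⟨by simp only [le_add_iff_nonneg_right]; positivity, by linarith⟩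
  have hvW : ∀ k < N, ‖v k‖ ≤ W := by
    intro k hk
    refine (hf.growth hK (ha.trans (hgrid k hk.le).1) (hwD k hk.le) _).trans ?_
    rw [hW]
    gcongr
    exact hyR k hk.le
  have hex : ∀ t ∈ Set.Ico a (a + τ), ∃ u,
      HasDerivWithinAt (polygon (y 0) a h N v) u (Set.Ici t) t ∧
      ‖u - f t (polygon (y 0) a h N v t) (ζ t)‖ ≤ B * (e ^ γ + S) := by
    intro t ht
    obtain ⟨m, hm, htm⟩ := exists_mem_grid_interval hh (N := N) (a := a) (t := t)
      (by rw [hNh]; exact ht)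
    have htm' := Set.Ico_subset_Icc_self htm
    have hm1 := (hgrid m hm.le).1
    refine ⟨v m, polygon_hasDerivWithinAt hh hm hyv htm, ?_⟩
    rw [polygon_eq hh.le hm hyv htm']
    refine hf.defect_le hL hα hβ₁ hβ₂ hγ hV hW0 he hh hh1 (ha.trans hm1) htm.1
      (by linarith [htm.2]) (hyR m hm.le)
      (norm_polygon_segment_le ⟨by linarith [htm.1], by linarith [htm.2]⟩ (hy m) (hyR m hm.le)
        (hyR (m + 1) hm)) (hwD m hm.le) (hζD t (Set.Ico_subset_Icc_self ht)) ?_ ?_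
    · rw [sub_add_cancel_left, norm_neg, norm_smul, Real.norm_of_nonneg (by linarith [htm.1]),
        mul_comm]
      exact mul_le_mul (hvW m hm) (by linarith [htm.2]) (by linarith [htm.1]) hW0
    · rw [norm_sub_rev, ← sub_add_sub_cancel _ (ζ (a + m * h))]
      refine norm_add_le_of_le ((hζV _ _ hm1 htm.1 ht.2.le).trans ?_) (hwe m hm.le)
      gcongr
      linarith [htm.2]
  choose! p' hp' hpε using hex
  intro k hk
  have key := norm_sub_le_of_approx_solutions (g := fun t y => f t y (ζ t)) (ε₁ := 0)
    (ε₂ := B * (e ^ γ + S)) (δ := e) (Λ := max H 0 * (1 + D)) (by positivity)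
    (fun t ht y₁ y₂ =>
      hf.one_sided (ha.trans ht.1) (hζD t (Set.Ico_subset_Icc_self ht)) y₁ y₂) le_rfl
    (by positivity) hz (continuous_polygon (y 0) a h N v).continuousOn hz' hp'
    (fun t _ => by rw [sub_self, norm_zero]) hpε
    (by rwa [polygon_zero hh.le hN hyv]) (a + k * h) (hgrid k hk)
  rw [polygon_grid hh.le hN hk hyv, zero_add, add_sub_cancel_left] at key
  rw [mul_right_comm]
  refine key.trans (mul_le_mul_of_nonneg_right ?_ (Real.exp_pos _).le)
  nlinarith [Real.rpow_nonneg he γ, mul_nonneg hB0 he]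

/-- The delayed values used by the Euler scheme on the `j`-th interval. -/
noncomputable def eulerDelay (f : ℝ → EuclideanSpace ℝ (Fin d) → EuclideanSpace ℝ (Fin d) →
    EuclideanSpace ℝ (Fin d)) (τ : ℝ) (η : EuclideanSpace ℝ (Fin d)) (N : ℕ) :
    ℕ → ℕ → EuclideanSpace ℝ (Fin d)
  | 0 => fun _ => η
  | j + 1 => eulerDDE f τ η N j

theorem eulerDDE_zero_right (τ : ℝ) (η : EuclideanSpace ℝ (Fin d)) (N j : ℕ) :
    eulerDDE f τ η N j 0 = eulerDelay f τ η N j N := by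
  cases j <;> rfl

theorem eulerDDE_succ_right (τ : ℝ) (η : EuclideanSpace ℝ (Fin d)) (N j k : ℕ) :
    eulerDDE f τ η N j (k + 1) = eulerDDE f τ η N j k
      + (τ / N) • f (j * τ + k * (τ / N)) (eulerDDE f τ η N j k) (eulerDelay f τ η N j k) := by
  cases j <;> rfl

theorem DDEAssumptions.norm_eulerDelay_le (hf : DDEAssumptions f K H L α β₁ β₂ γ) (hK : 0 ≤ K)
    {τ : ℝ} (hτ : 0 ≤ τ) (η : EuclideanSpace ℝ (Fin d)) {N : ℕ} (hN : 0 < N) (j : ℕ) :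
    ∀ k ≤ N, ‖eulerDelay f τ η N j k‖ ≤ aprioriBound K τ ‖η‖ j := by
  induction j with
  | zero => exact fun k _ => le_rfl
  | succ j ih =>
    have hN' : (0 : ℝ) < N := by exact_mod_cast hN
    have hD := aprioriBound_nonneg (K := K) (τ := τ) (norm_nonneg η) j
    intro k hk
    have := euler_growth (h := τ / N) (G := K * (1 + aprioriBound K τ ‖η‖ j)) (by positivity)
      (by positivity) (fun k _ => eulerDDE_succ_right (f := f) τ η N j k)
      (fun k hk => hf.growth hK (by positivity) (ih k hk.le) _) k hk
    rw [mul_div_cancel₀ _ hN'.ne', eulerDDE_zero_right] at this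
    refine this.trans ?_
    rw [aprioriBound]
    gcongr
    exact ih N le_rfl

theorem grid_error_of_delay_error {τ : ℝ} (hτ : 0 < τ) (hK : 0 < K) (hL : 0 ≤ L)
    (hα : α ∈ Set.Ioc (0 : ℝ) 1) (hβ₁ : β₁ ∈ Set.Ioc (0 : ℝ) 1) (hβ₂ : β₂ ∈ Set.Ioc (0 : ℝ) 1)
    (hγ : γ ∈ Set.Ioc (0 : ℝ) 1) (η : EuclideanSpace ℝ (Fin d)) (j : ℕ) :
    ∃ C, 0 ≤ C ∧ ∀ f : ℝ → EuclideanSpace ℝ (Fin d) → EuclideanSpace ℝ (Fin d) →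
        EuclideanSpace ℝ (Fin d), DDEAssumptions f K H L α β₁ β₂ γ → ∀ n, j ≤ n → ∀ z,
      IsDDESolution f τ η n z → ∀ N : ℕ, 0 < N → τ / N ≤ 1 → ∀ e, 0 ≤ e →
      (∀ k ≤ N, ‖z (gridPoint τ N j k - τ) - eulerDelay f τ η N j k‖ ≤ e) →
      ∀ k ≤ N, ‖z (gridPoint τ N j k) - eulerDDE f τ η N j k‖
        ≤ C * (e + e ^ γ + errorRate α β₁ β₂ γ (τ / N) 0) := by
  set D := aprioriBound K τ ‖η‖ j with hDdef
  set R := aprioriBound K τ ‖η‖ (j + 1) with hRdef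
  have hD : 0 ≤ D := aprioriBound_nonneg (norm_nonneg _) j
  have hR : 0 ≤ R := aprioriBound_nonneg (norm_nonneg _) (j + 1)
  refine ⟨(1 + L * ((1 + 2 * R) * (1 + 2 * D) * (1 + K * (1 + D) * (1 + R))
    * (2 + K * (1 + D) * (1 + D)))) * Real.exp ((2 * (max H 0 * (1 + D)) + 1) * τ),
    by positivity, ?_⟩
  intro f hf n hjn z hz N hN hh1 e he hdelay
  have hN' : (0 : ℝ) < N := by exact_mod_cast hN
  have hNh : (N : ℝ) * (τ / N) = τ := mul_div_cancel₀ _ hN'.ne'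
  have hj0 : 0 ≤ (j : ℝ) * τ := by positivity
  have hT := IsDDESolution.step_le hτ.le hjn
  refine hf.euler_error_interval hK.le hL hα hβ₁ hβ₂ hγ (a := j * τ) (τ := τ)
    (ζ := fun t => z (t - τ)) (by positivity) he (by positivity) hh1 hj0 hN hNh
    ((hz.continuousOn hτ.le).mono (Set.Icc_subset_Icc (by linarith) hT))
    (fun t ht => hz.hasDerivWithinAt_Ici ⟨hj0.trans ht.1, ht.2.trans_le hT⟩)
    (fun t ht => hz.norm_le hf hK hτ (by omega) _ ⟨by linarith [ht.1], by linarith [ht.2]⟩)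
    (fun s t hs hst ht => ?_)
    (hf.norm_eulerDelay_le hK.le hτ.le η hN j) hdelay
    (hf.norm_eulerDelay_le hK.le hτ.le η hN (j + 1)) (eulerDDE_succ_right τ η N j) ?_
  · have := hz.norm_sub_le hf hK hτ (by omega : j ≤ n + 1) (s := s - τ) (t := t - τ)
      (by linarith) (by linarith) (by linarith)
    rwa [sub_sub_sub_cancel_right] at this
  · have := hdelay N le_rfl
    rw [gridPoint, hNh, add_sub_cancel_right] at this
    rwa [eulerDDE_zero_right]

theorem exists_grid_error_const {τ : ℝ} (hτ : 0 < τ) (hK : 0 < K) (hL : 0 ≤ L)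
    (hα : α ∈ Set.Ioc (0 : ℝ) 1) (hβ₁ : β₁ ∈ Set.Ioc (0 : ℝ) 1) (hβ₂ : β₂ ∈ Set.Ioc (0 : ℝ) 1)
    (hγ : γ ∈ Set.Ioc (0 : ℝ) 1) (η : EuclideanSpace ℝ (Fin d)) (j : ℕ) :
    ∃ C, 0 ≤ C ∧ ∀ f : ℝ → EuclideanSpace ℝ (Fin d) → EuclideanSpace ℝ (Fin d) →
        EuclideanSpace ℝ (Fin d), DDEAssumptions f K H L α β₁ β₂ γ → ∀ n, j ≤ n → ∀ z,
      IsDDESolution f τ η n z → ∀ N : ℕ, 0 < N → τ / N ≤ 1 →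
      ∀ k ≤ N, ‖z (gridPoint τ N j k) - eulerDDE f τ η N j k‖
        ≤ C * errorRate α β₁ β₂ γ (τ / N) j := by
  induction j with
  | zero =>
    obtain ⟨C, hC, h⟩ := grid_error_of_delay_error (H := H) hτ hK hL hα hβ₁ hβ₂ hγ η 0
    refine ⟨C, hC, fun f hf n hn z hz N hN hh k hk => ?_⟩
    have hN' : (0 : ℝ) < N := by exact_mod_cast hN
    have := h f hf n hn z hz N hN hh 0 le_rfl (fun k hk => by
      have h1 : (k : ℝ) * (τ / N) ≤ N * (τ / N) := by gcongr
      rw [mul_div_cancel₀ _ hN'.ne'] at h1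
      have h2 : 0 ≤ (k : ℝ) * (τ / N) := by positivity
      rw [hz.history _ (by simp only [gridPoint]; constructor <;> push_cast <;> linarith),
        eulerDelay, sub_self, norm_zero]) k hk
    rwa [Real.zero_rpow hγ.1.ne', add_zero, zero_add] at this
  | succ j ih =>
    obtain ⟨C', hC', h'⟩ := ih
    obtain ⟨C, hC, h⟩ := grid_error_of_delay_error (H := H) hτ hK hL hα hβ₁ hβ₂ hγ η (j + 1)
    refine ⟨C * (2 * C' + 2), by positivity, fun f hf n hn z hz N hN hh k hk => ?_⟩
    have hN' : (0 : ℝ) < N := by exact_mod_cast hN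
    have hh0 : 0 < τ / N := by positivity
    have h1 := h f hf n hn z hz N hN hh (C' * errorRate α β₁ β₂ γ (τ / N) j)
      (mul_nonneg hC' (errorRate_nonneg hh0.le j)) (fun k hk => by
        have h2 := h' f hf n (by omega) z hz N hN hh k hk
        have h3 : gridPoint τ N (j + 1) k - τ = gridPoint τ N j k := by
          simp only [gridPoint]
          push_cast
          ring
        rwa [h3]) k hk
    rw [mul_assoc]
    exact h1.trans (mul_le_mul_of_nonneg_left
      (error_add_rpow_add_errorRate_le hα.1.le hβ₁.1.le hβ₂.1.le hγ.1.le hγ.2 hh0 hh hC' j) hC)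

end EulerError

theorem theorem1 (d : ℕ) (τ : ℝ) (hτ : 0 < τ) (η : EuclideanSpace ℝ (Fin d)) (n : ℕ)
    (K H L α β₁ β₂ γ : ℝ) (hK : 0 < K) (hL : 0 < L)
    (hα : α ∈ Set.Ioc (0 : ℝ) 1) (hβ₁ : β₁ ∈ Set.Ioc (0 : ℝ) 1) (hβ₂ : β₂ ∈ Set.Ioc (0 : ℝ) 1)
    (hγ : γ ∈ Set.Ioc (0 : ℝ) 1) :
    ∃ C : ℕ → ℝ, (∀ j ≤ n, 0 ≤ C j) ∧
      ∀ f : ℝ → EuclideanSpace ℝ (Fin d) → EuclideanSpace ℝ (Fin d) → EuclideanSpace ℝ (Fin d),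
        DDEAssumptions f K H L α β₁ β₂ γ →
        ∃ z : ℝ → EuclideanSpace ℝ (Fin d),
          IsDDESolution f τ η n z ∧
          (∀ w : ℝ → EuclideanSpace ℝ (Fin d), IsDDESolution f τ η n w →
            Set.EqOn w z (Set.Icc (-τ) (((n : ℝ) + 1) * τ))) ∧
          ∀ N : ℕ, 2 * ⌈τ⌉₊ ≤ N → ∀ h : ℝ, h = τ / (N : ℝ) →
            (∀ k ≤ N, ‖z (gridPoint τ N 0 k) - eulerDDE f τ η N 0 k‖
              ≤ C 0 * (h ^ min α γ + h ^ β₁ + h ^ β₂)) ∧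
            (∀ j, 1 ≤ j → j ≤ n → ∀ k ≤ N,
              ‖z (gridPoint τ N j k) - eulerDDE f τ η N j k‖
                ≤ C j * ∑ l ∈ Finset.Icc 1 j,
                  (h ^ (1 / 2 * γ ^ (l - 1)) + h ^ (γ ^ l * min α γ)
                    + h ^ (β₁ * γ ^ l) + h ^ (β₂ * γ ^ l))) ∧
            (γ = 1 → ∀ j, 1 ≤ j → j ≤ n → ∀ k ≤ N,
              ‖z (gridPoint τ N j k) - eulerDDE f τ η N j k‖
                ≤ (j : ℝ) * C j * (h ^ (1 / 2 : ℝ) + h ^ α + h ^ β₁ + h ^ β₂)) := by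
  choose C hC herr using exists_grid_error_const (H := H) hτ hK hL.le hα hβ₁ hβ₂ hγ η
  refine ⟨C, fun j _ => hC j, fun f hf => ?_⟩
  obtain ⟨z, hz⟩ := hf.exists_solution hK.le hτ η n
  refine ⟨z, hz, fun w hw => hz.eqOn hf hK hτ hw, ?_⟩
  rintro N hN h rfl
  have hceil : 0 < ⌈τ⌉₊ := Nat.ceil_pos.2 hτ
  have hN0 : 0 < N := by omega
  have hN' : (0 : ℝ) < N := by exact_mod_cast hN0
  have hh1 : τ / N ≤ 1 := by
    rw [div_le_one hN']
    exact (Nat.le_ceil τ).trans (by exact_mod_cast (by omega : ⌈τ⌉₊ ≤ N))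
  have hh0 : 0 < τ / N := by positivity
  have hsum : ∀ j, 1 ≤ j → j ≤ n → ∀ k ≤ N,
      ‖z (gridPoint τ N j k) - eulerDDE f τ η N j k‖
        ≤ C j * ∑ l ∈ Finset.Icc 1 j,
          ((τ / N) ^ (1 / 2 * γ ^ (l - 1)) + (τ / N) ^ (γ ^ l * min α γ)
            + (τ / N) ^ (β₁ * γ ^ l) + (τ / N) ^ (β₂ * γ ^ l)) := by
    intro j hj hjn k hk
    refine (herr j f hf n hjn z hz N hN0 hh1 k hk).trans
      (mul_le_mul_of_nonneg_left ?_ (hC j))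
    refine le_trans ?_ (Finset.single_le_sum (fun l _ => by positivity)
      (Finset.mem_Icc.2 ⟨hj, le_rfl⟩))
    rw [errorRate]
    have : 0 ≤ (τ / N) ^ (1 / 2 * γ ^ (j - 1)) := by positivity
    linarith
  refine ⟨fun k hk => ?_, hsum, ?_⟩
  · have := herr 0 f hf n n.zero_le z hz N hN0 hh1 k hk
    simpa [errorRate] using this
  · rintro rfl j hj hjn k hk
    have := hsum j hj hjn k hk
    simp only [one_pow, mul_one, one_mul, min_eq_left hα.2, Finset.sum_const, Nat.card_Icc,
      add_tsub_cancel_right, nsmul_eq_mul] at this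
    linarith
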